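/- Let $X=[0,1]^2$, let the types $x=(x_1,x_2)$ be uniformly distributed on $X$ (two items with i.i.d. uniform values), and let $S=\{(p_1,p_2): p_1,p_2\ge 0,\ p_1+p_2\le 1\}$ be the set of permissible allocations. A mechanism assigns to each reported type $x\in X$ an allocation $s(x)\in S$ and a payment $p(x)\in\mathbb R$; its surplus function is $u(x)=s(x)\cdot x-p(x)$. Let $U(X,S)$ be the set of convex functions on $X$ having at every point of $X$ a subgradient in $S$ (subgradients and convexity are relative to $X$), let $\ell_S(x,y)=\sup_{s\in S}s\cdot(x-y)$, and for signed measures write $\nu\succeq_{X,S}\mu$ if $\int u\,d\nu\ge\int u\,d\mu$ for all $u\in U(X,S)$. Let $\mu=\mu_+-\mu_-$, where $\mu_+$ is the sum of a unit point mass at the origin and of unit masses uniformly distributed on each of the segments $(1,0)$–$(1,1)$ and $(0,1)$–$(1,1)$, and $\mu_-$ is mass $3$ uniformly distributed on $X$. Put $q=1/\sqrt3$, $u^*(x)=\max(0,\,x_1-q,\,x_2-q)$, and for $s\in S$ let $\mathrm{cell}(s)$ be the set of $x\in X$ at which $s$ is a subgradient of $u^*$. Let $$F(a)=\begin{cases}3(1-q)a,&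 a\le q,\\ 1-\tfrac32(1-a)^2,& a> q,\end{cases}$$ and let $\gamma^*$ be the measure on $X\times X$ that is the sum of the images of the restriction of $\mu_-$ to $\mathrm{cell}(0,0)$ under $y\mapsto((0,0),y)$, of its restriction to $\mathrm{cell}(1,0)$ under $y\mapsto((1,1-F(y_1-y_2)),y)$, and of its restriction to $\mathrm{cell}(0,1)$ under $y\mapsto((1-F(y_2-y_1),1),y)$. Then: 1. The menu "nothing for free, or either single item at price $1/\sqrt3$" is optimal: with any tie-breaking, the mechanism in which every type takes a utility-maximizing option of this menu maximizes expected revenue among all incentive compatible and individually rational mechanisms with allocations in $S$, and its surplus function is $u^*$. 2. Every incentive compatible mechanism with allocations in $S$ has surplus function $u\in U(X,S)$, has an integrable payment rule, and has expected revenue $\int u\,d\mu-u(0)$. 3. $u^*\in U(X,S)$ and $u^*$ attains $\max_{u\in U(X,S)}\int u\,d\mu$. 4. $\mathrm{cell}(0,0)=\{x\in X: x_1,x_2\le q\}$, $\mathrm{cell}(1,0)=\{x\in X: x_1\ge q,\ x_1\ge x_2\}$, $\mathrm{cell}(0,1)=\{x\in X: x_2\ge q,\ x_2\ge x_1\}$,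 and $\mu$ vanishes on each of these three sets. 5. $\gamma^*$ certifies optimality: its marginals are $\gamma^*_1=\mu_+$ and $\gamma^*_2=\mu_-$; for $\gamma^*$-almost every $(x,y)$ the points $x$ and $y$ lie in a common one of the three cells and $u^*(x)-u^*(y)=\ell_S(x,y)$; and $\gamma^*$ attains the minimum of $\int\ell_S\,d\gamma$ over all finite positive measures $\gamma$ on $X\times X$ with $\gamma_1-\gamma_2\succeq_{X,S}\mu$, with $\int\ell_S\,d\gamma^*=\int u^*\,d\mu$. -/

import Mathlib

open MeasureTheory Set
open scoped NNReal

noncomputable section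

namespace OptimalMechanism

/-! ### Mechanisms, feasible surplus functions, and the dual problem -/

section General

variable {n : ℕ}

/-- A direct revelation mechanism: each report is mapped to an allocation and a payment. -/
structure Mechanism (n : ℕ) where
  alloc : (Fin n → ℝ) → (Fin n → ℝ)
  pay : (Fin n → ℝ) → ℝ

/-- Utility of a truthfully reporting agent of type `x`. -/
def Mechanism.surplus (M : Mechanism n) (x : Fin n → ℝ) : ℝ :=
  M.alloc x ⬝ᵥ x - M.pay x

/-- All allocations used on the type space `X` are permissible, i.e. belong to `S`. -/
def Mechanism.Feasible (X S : Set (Fin n → ℝ)) (M : Mechanism n) : Prop :=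
  ∀ x ∈ X, M.alloc x ∈ S

/-- Incentive compatibility: no type in `X` gains by reporting another type in `X`. -/
def Mechanism.Truthful (X : Set (Fin n → ℝ)) (M : Mechanism n) : Prop :=
  ∀ x ∈ X, ∀ y ∈ X, M.alloc y ⬝ᵥ x - M.pay y ≤ M.alloc x ⬝ᵥ x - M.pay x

/-- Individual rationality. -/
def Mechanism.Rational (X : Set (Fin n → ℝ)) (M : Mechanism n) : Prop :=
  ∀ x ∈ X, 0 ≤ M.surplus x

/-- Expected payment when the type is drawn from `f`. -/
def Mechanism.revenue (f : Measure (Fin n → ℝ)) (M : Mechanism n) : ℝ :=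
  ∫ x, M.pay x ∂f

/-- `M` is a revenue-maximal feasible, truthful and individually rational mechanism. -/
def Mechanism.IsOptimal (X S : Set (Fin n → ℝ)) (f : Measure (Fin n → ℝ)) (M : Mechanism n) :
    Prop :=
  M.Feasible X S ∧ M.Truthful X ∧ M.Rational X ∧
    ∀ M' : Mechanism n, M'.Feasible X S → M'.Truthful X → M'.Rational X →
      M'.revenue f ≤ M.revenue f

/-- `M` arises by letting every type in `X` pick a favourite option from a menu of pairs
(allocation, price); ties may be broken in any way. -/
def Mechanism.Implements (X : Set (Fin n → ℝ)) (menu : Set ((Fin n → ℝ) × ℝ))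
    (M : Mechanism n) : Prop :=
  ∀ x ∈ X, (M.alloc x, M.pay x) ∈ menu ∧ ∀ o ∈ menu, o.1 ⬝ᵥ x - o.2 ≤ M.surplus x

/-- The subgradients at `x` of a function `u` on `X`. -/
def subgradients (X : Set (Fin n → ℝ)) (u : (Fin n → ℝ) → ℝ) (x : Fin n → ℝ) :
    Set (Fin n → ℝ) :=
  {s | ∀ y ∈ X, u x + s ⬝ᵥ (y - x) ≤ u y}

/-- The set `U(X, S)` of convex functions on `X` that have, at every point of `X`, a subgradient
in `S`. Only the values on `X` matter. -/
def surplusFunctions (X S : Set (Fin n → ℝ)) : Set ((Fin n → ℝ) → ℝ) :=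
  {u | ConvexOn ℝ X u ∧ ∀ x ∈ X, ∃ s ∈ S, s ∈ subgradients X u x}

/-- The types in `X` that receive allocation `s` under `u`. -/
def cell (X : Set (Fin n → ℝ)) (u : (Fin n → ℝ) → ℝ) (s : Fin n → ℝ) : Set (Fin n → ℝ) :=
  {x ∈ X | s ∈ subgradients X u x}

/-- The support function `ℓ_S(x, y) = sup_{s ∈ S} s · (x - y)`. -/
def ell (S : Set (Fin n → ℝ)) (x y : Fin n → ℝ) : ℝ :=
  sSup ((fun s => s ⬝ᵥ (x - y)) '' S)

/-- The integral stochastic order `ν ⪰_{X,S} μ`. -/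
def Dominates (X S : Set (Fin n → ℝ)) (ν μ : SignedMeasure (Fin n → ℝ)) : Prop :=
  ∀ u ∈ surplusFunctions X S, ∫ᵛ x, u x ∂<•μ ≤ ∫ᵛ x, u x ∂<•ν

/-- Feasible points of the dual problem: finite positive measures on `X × X` with
`γ₁ - γ₂ ⪰_{X,S} μ`. -/
def DualFeasible (X S : Set (Fin n → ℝ)) (μ : SignedMeasure (Fin n → ℝ))
    (γ : Measure ((Fin n → ℝ) × (Fin n → ℝ))) [IsFiniteMeasure γ] : Prop :=
  γ (X ×ˢ X)ᶜ = 0 ∧ Dominates X S (γ.fst.toSignedMeasure - γ.snd.toSignedMeasure) μ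

end General

/-! ### Two i.i.d. uniform items, allocate at most one -/

/-- The type space `[0,1]²`. -/
def square : Set (Fin 2 → ℝ) := Icc 0 1

/-- Permissible allocations: at most one item in expectation. -/
def atMostOne : Set (Fin 2 → ℝ) := {p | 0 ≤ p 0 ∧ 0 ≤ p 1 ∧ p 0 + p 1 ≤ 1}

/-- Two independent values, each uniform on `[0,1]`. -/
def uniformTypes : Measure (Fin 2 → ℝ) :=
  Measure.pi fun _ => (volume : Measure ℝ).restrict (Icc 0 1)

/-- The positive part of the transformed measure: a unit mass at the origin and a unit mass
uniformly distributed on each of the segments `(1,0)-(1,1)` and `(0,1)-(1,1)`. -/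
def muPos : Measure (Fin 2 → ℝ) :=
  Measure.dirac 0
    + ((volume : Measure ℝ).restrict (Icc 0 1)).map (fun t => ![1, t])
    + ((volume : Measure ℝ).restrict (Icc 0 1)).map (fun t => ![t, 1])

/-- The negative part of the transformed measure: mass `3` uniformly distributed on the square. -/
def muNeg : Measure (Fin 2 → ℝ) := (3 : ℝ≥0) • uniformTypes

instance : IsFiniteMeasure uniformTypes := by
  unfold uniformTypes; infer_instance

instance : IsFiniteMeasure muPos := by
  unfold muPos; infer_instance

instance : IsFiniteMeasure muNeg := by
  unfold muNeg; infer_instance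

/-- The transformed measure `μ` of the uniform distribution on the unit square. -/
def mu : SignedMeasure (Fin 2 → ℝ) := muPos.toSignedMeasure - muNeg.toSignedMeasure

/-- The price `1/√3`. -/
def price : ℝ := 1 / √3

/-- The menu: nothing for free, or either single item at the price `1/√3`. -/
def eitherItemMenu : Set ((Fin 2 → ℝ) × ℝ) :=
  {(![0, 0], 0), (![1, 0], price), (![0, 1], price)}

open Classical in
/-- The mechanism offering either item at price `1/√3`, with one choice of tie-breaking. -/
def eitherItem : Mechanism 2 where
  alloc x := if max (x 0) (x 1) < price then ![0, 0] else if x 1 ≤ x 0 then ![1, 0] else ![0, 1]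
  pay x := if max (x 0) (x 1) < price then 0 else price

/-- The consumer surplus function of that menu. -/
def uStar (x : Fin 2 → ℝ) : ℝ := max 0 (max (x 0 - price) (x 1 - price))

/-- Neither item is worth more than the price. -/
def noSale : Set (Fin 2 → ℝ) := {x ∈ square | x 0 ≤ price ∧ x 1 ≤ price}

/-- Item one is worth at least the price and is (weakly) preferred to item two. -/
def sellFirst : Set (Fin 2 → ℝ) := {x ∈ square | price ≤ x 0 ∧ x 1 ≤ x 0}

/-- Item two is worth at least the price and is (weakly) preferred to item one. -/
def sellSecond : Set (Fin 2 → ℝ) := {x ∈ square | price ≤ x 1 ∧ x 0 ≤ x 1}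

open Classical in
/-- For `0 ≤ a ≤ 1`, the `muNeg`-mass of the points of `sellFirst` with `x 0 - x 1 ≤ a`. -/
def stripMass (a : ℝ) : ℝ :=
  if a ≤ price then 3 * (1 - price) * a else 1 - 3 / 2 * (1 - a) ^ 2

/-- The dual matching `γ*`. In the no-sale cell all negative mass is matched to the origin. In the
cell where item one is sold, `y` is matched to the point of the right edge obtained by the
monotone rearrangement of the `muNeg`-law of `y 0 - y 1` in that cell onto the uniform law of
the edge parameter; symmetrically for item two and the top edge. -/
def gammaStar : Measure ((Fin 2 → ℝ) × (Fin 2 → ℝ)) :=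
  (muNeg.restrict noSale).map (fun y => (0, y))
    + (muNeg.restrict sellFirst).map (fun y => (![1, 1 - stripMass (y 0 - y 1)], y))
    + (muNeg.restrict sellSecond).map (fun y => (![1 - stripMass (y 1 - y 0), 1], y))

instance : IsFiniteMeasure gammaStar := by
  unfold gammaStar; infer_instance

end OptimalMechanism

end

noncomputable section

namespace OptimalMechanism

/-! ### Subgradients, surplus functions and dual measures on a general type space -/

section General

variable {n : ℕ} {X S : Set (Fin n → ℝ)}

/-! The proof is linear programming duality with an explicit dual solution. Truthfulness says that
the allocation is a subgradient of the surplus `u`, so almost everywhere the payment is `x · ∇u -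
u`. Integrating by parts in each coordinate moves the derivatives onto the two edges through
`(1,1)`, and revenue becomes `∫ u dμ - u(0)` (`revenue_eq`). Rationality gives `u(0) ≥ 0`, so it is
enough to maximize the linear functional `∫ u dμ`.

A function with subgradients in `S` satisfies `u x - u y ≤ ell S x y`. Integrating this against a
dual feasible `γ` gives weak duality (`integral_mu_le_of_dualFeasible`). There is equality for
`uStar` and `gammaStar` because `gammaStar` couples `muPos` with `muNeg` and lives on pairs where
that inequality is tight.

The coupling is built cell by cell, each cell carrying mass 1 of both measures; for `noSale` this is
`3 * price ^ 2 = 1`. There all negative mass goes to the origin. In `sellFirst`, the pair of `(1,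
t)` and `y` is tight as soon as `t - y 1 ≤ 1 - y 0`, that is `y 0 - y 1 ≤ 1 - t`. Taking `1 - t = F
(y 0 - y 1)`, with `F = stripMass` the distribution function of `y 0 - y 1` on the cell, makes `t`
uniform (`map_stripMass_sellFirst`), and tightness reduces to `a ≤ F a` on `[0,1]` (`le_stripMass`,
used in `match_right`). The remaining cell follows by exchanging the items. -/

theorem sub_le_ell (hS : IsCompact S) {u : (Fin n → ℝ) → ℝ} (hu : u ∈ surplusFunctions X S)
    {x y : Fin n → ℝ} (hx : x ∈ X) (hy : y ∈ X) : u x - u y ≤ ell S x y := by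
  obtain ⟨s, hs, hsub⟩ := hu.2 x hx
  -- Boundedness is essential: a real `sSup` of an unbounded set has the default value 0.
  have hb : BddAbove ((fun s => s ⬝ᵥ (x - y)) '' S) :=
    (hS.image (by unfold dotProduct; fun_prop)).bddAbove
  have h1 := le_csSup hb (mem_image_of_mem _ hs)
  have h2 := hsub y hy
  have h3 : s ⬝ᵥ (y - x) = -(s ⬝ᵥ (x - y)) := by rw [← dotProduct_neg, neg_sub]
  unfold ell
  linarith

/-- A type `y` that reports `x` earns `surplus x + alloc x · (y - x)`, so the incentive constraint
of `y` against `x` is the subgradient inequality at `x`. -/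
theorem Mechanism.Truthful.alloc_mem_subgradients {M : Mechanism n} (hT : M.Truthful X)
    {x : Fin n → ℝ} (hx : x ∈ X) : M.alloc x ∈ subgradients X M.surplus x := by
  intro y hy
  have := hT y hy x hx
  simp only [Mechanism.surplus, dotProduct_sub]
  linarith

/-- A function on a convex set with a subgradient at every point is convex. -/
theorem convexOn_of_subgradients (hX : Convex ℝ X) {u : (Fin n → ℝ) → ℝ}
    (h : ∀ x ∈ X, ∃ s, s ∈ subgradients X u x) : ConvexOn ℝ X u := by
  refine ⟨hX, fun x hx y hy a b ha hb hab => ?_⟩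
  obtain ⟨s, hs⟩ := h _ (hX hx hy ha hb hab)
  have h1 := mul_le_mul_of_nonneg_left (hs x hx) ha
  have h2 := mul_le_mul_of_nonneg_left (hs y hy) hb
  simp only [dotProduct_sub, dotProduct_add, dotProduct_smul, smul_eq_mul] at h1 h2 ⊢
  obtain rfl : a = 1 - b := by linarith
  nlinarith

theorem Mechanism.surplus_mem_surplusFunctions (hX : Convex ℝ X) {M : Mechanism n}
    (hF : M.Feasible X S) (hT : M.Truthful X) : M.surplus ∈ surplusFunctions X S :=
  ⟨convexOn_of_subgradients hX fun _ hx => ⟨_, hT.alloc_mem_subgradients hx⟩,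
    fun x hx => ⟨_, hF x hx, hT.alloc_mem_subgradients hx⟩⟩

/-- The subgradient of a function at an interior point of differentiability is its derivative. -/
theorem fderiv_eq_dotProduct {u : (Fin n → ℝ) → ℝ} {x s : Fin n → ℝ} (hX : X ∈ nhds x)
    (hu : DifferentiableAt ℝ u x) (hs : s ∈ subgradients X u x) (w : Fin n → ℝ) :
    fderiv ℝ u x w = s ⬝ᵥ w := by
  let L : (Fin n → ℝ) →L[ℝ] ℝ := ∑ i, s i • ContinuousLinearMap.proj i
  have hL : ∀ y, L y = s ⬝ᵥ y := fun y => by simp [L, dotProduct]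
  -- The subgradient inequality says that `u` minus the linear form `s` is minimal at `x`, so its
  -- derivative vanishes there.
  have hmin : IsLocalMin (fun y => u y - L y) x := by
    filter_upwards [hX] with y hy
    have := hs y hy
    rw [dotProduct_sub] at this
    simp only [hL]
    linarith
  have h0 := hmin.hasFDerivAt_eq_zero (hu.hasFDerivAt.sub L.hasFDerivAt)
  rw [← hL, sub_eq_zero.1 h0]

theorem integral_toSignedMeasure_sub {Ω : Type*} [MeasurableSpace Ω] {α β : Measure Ω}
    [IsFiniteMeasure α] [IsFiniteMeasure β] {u : Ω → ℝ} (hα : Integrable u α)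
    (hβ : Integrable u β) :
    ∫ᵛ x, u x ∂<•(α.toSignedMeasure - β.toSignedMeasure) = ∫ x, u x ∂α - ∫ x, u x ∂β := by
  rw [VectorMeasure.integral_sub_vectorMeasure, VectorMeasure.integral_toSignedMeasure,
    VectorMeasure.integral_toSignedMeasure]
  · simpa [VectorMeasure.Integrable] using hα
  · simpa [VectorMeasure.Integrable] using hβ

theorem integrable_of_continuousOn {ν : Measure (Fin n → ℝ)} [IsFiniteMeasure ν]
    {u : (Fin n → ℝ) → ℝ} (hX : IsCompact X) (hu : ContinuousOn u X) (hν : ν Xᶜ = 0) :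
    Integrable u ν := by
  have h := hu.integrableOn_compact (μ := ν) hX
  rwa [IntegrableOn, Measure.restrict_eq_self_of_ae_mem (mem_ae_iff.2 hν)] at h

/-- Integrating against the difference of the marginals of a measure on `X × X`. -/
theorem integral_fst_sub_snd {γ : Measure ((Fin n → ℝ) × (Fin n → ℝ))} [IsFiniteMeasure γ]
    (hX : IsCompact X) (hγ : γ (X ×ˢ X)ᶜ = 0) {u : (Fin n → ℝ) → ℝ} (hu : ContinuousOn u X) :
    ∫ᵛ x, u x ∂<•(γ.fst.toSignedMeasure - γ.snd.toSignedMeasure)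
      = ∫ z, (u z.1 - u z.2) ∂γ ∧ Integrable (fun z => u z.1 - u z.2) γ := by
  have h1 : γ.fst Xᶜ = 0 := by
    rw [Measure.fst_apply hX.measurableSet.compl]
    exact measure_mono_null (t := (X ×ˢ X)ᶜ) (fun z hz h => hz (mem_prod.1 h).1) hγ
  have h2 : γ.snd Xᶜ = 0 := by
    rw [Measure.snd_apply hX.measurableSet.compl]
    exact measure_mono_null (t := (X ×ˢ X)ᶜ) (fun z hz h => hz (mem_prod.1 h).2) hγ
  have i1 : Integrable u γ.fst := integrable_of_continuousOn hX hu h1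
  have i2 : Integrable u γ.snd := integrable_of_continuousOn hX hu h2
  have j1 : Integrable (fun z => u z.1) γ := i1.comp_measurable measurable_fst
  have j2 : Integrable (fun z => u z.2) γ := i2.comp_measurable measurable_snd
  refine ⟨?_, j1.sub j2⟩
  rw [integral_toSignedMeasure_sub i1 i2, integral_sub j1 j2, Measure.fst, Measure.snd,
    integral_map measurable_fst.aemeasurable i1.1, integral_map measurable_snd.aemeasurable i2.1]

end General

/-! ### The square, the allocation triangle and its support function -/

theorem mem_square {x : Fin 2 → ℝ} : x ∈ square ↔ (0 ≤ x 0 ∧ x 0 ≤ 1) ∧ 0 ≤ x 1 ∧ x 1 ≤ 1 := by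
  simp only [square, mem_Icc, Pi.le_def, Fin.forall_fin_two, Pi.zero_apply, Pi.one_apply]
  tauto

theorem isCompact_square : IsCompact square := isCompact_Icc

theorem convex_square : Convex ℝ square := convex_Icc 0 1

theorem isCompact_atMostOne : IsCompact atMostOne := by
  refine isCompact_square.of_isClosed_subset ?_ fun p hp => ?_
  · have h0 : Continuous fun p : Fin 2 → ℝ => p 0 := continuous_apply 0
    have h1 : Continuous fun p : Fin 2 → ℝ => p 1 := continuous_apply 1
    exact (isClosed_le continuous_const h0).inter
      ((isClosed_le continuous_const h1).inter (isClosed_le (h0.add h1) continuous_const))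
  · obtain ⟨h0, h1, h2⟩ := hp
    exact mem_square.2 ⟨⟨h0, by linarith⟩, h1, by linarith⟩

/-- A linear form on the triangle is maximal at one of the vertices `(0,0)`, `(1,0)`, `(0,1)`. -/
theorem ell_atMostOne (x y : Fin 2 → ℝ) :
    ell atMostOne x y = max 0 (max (x 0 - y 0) (x 1 - y 1)) := by
  refine IsLUB.csSup_eq ⟨?_, fun b hb => ?_⟩ ⟨_, mem_image_of_mem _ (?_ : (0 : Fin 2 → ℝ) ∈ _)⟩
  · rintro _ ⟨s, ⟨h0, h1, h2⟩, rfl⟩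
    simp only [dotProduct, Fin.sum_univ_two, Pi.sub_apply]
    set m := max 0 (max (x 0 - y 0) (x 1 - y 1))
    have hm : 0 ≤ m := le_max_left _ _
    have hm0 : x 0 - y 0 ≤ m := (le_max_left _ _).trans (le_max_right _ _)
    have hm1 : x 1 - y 1 ≤ m := (le_max_right _ _).trans (le_max_right _ _)
    nlinarith [mul_le_mul_of_nonneg_left hm0 h0, mul_le_mul_of_nonneg_left hm1 h1]
  · have key : ∀ s ∈ atMostOne, s 0 * (x 0 - y 0) + s 1 * (x 1 - y 1) ≤ b := fun s hs => by
      simpa [dotProduct, Fin.sum_univ_two] using hb (mem_image_of_mem _ hs)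
    refine max_le ?_ (max_le ?_ ?_)
    · simpa using key ![0, 0] (by simp [atMostOne])
    · simpa using key ![1, 0] (by simp [atMostOne])
    · simpa using key ![0, 1] (by simp [atMostOne])
  · simp [atMostOne]

theorem continuous_ell_atMostOne :
    Continuous fun z : (Fin 2 → ℝ) × (Fin 2 → ℝ) => ell atMostOne z.1 z.2 := by
  simp only [ell_atMostOne]
  fun_prop

/-- `ell` is at most the distance in the sup norm. This regularity makes every surplus function
integrable and allows a Lipschitz extension that is differentiable almost everywhere. -/
theorem lipschitzOnWith_of_mem_surplusFunctions {u : (Fin 2 → ℝ) → ℝ}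
    (hu : u ∈ surplusFunctions square atMostOne) : LipschitzOnWith 1 u square := by
  have h : ∀ x ∈ square, ∀ y ∈ square, u x - u y ≤ dist x y := fun x hx y hy => by
    refine (sub_le_ell isCompact_atMostOne hu hx hy).trans ?_
    rw [ell_atMostOne]
    exact max_le dist_nonneg (max_le ((le_abs_self _).trans (dist_le_pi_dist x y 0))
      ((le_abs_self _).trans (dist_le_pi_dist x y 1)))
  refine LipschitzOnWith.of_dist_le_mul fun x hx y hy => ?_
  rw [NNReal.coe_one, one_mul, Real.dist_eq, abs_le]
  have h1 := h x hx y hy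
  have h2 := h y hy x hx
  rw [dist_comm] at h2
  constructor <;> linarith

/-! ### The uniform law and the transformed measure -/

theorem uniformTypes_eq : uniformTypes = volume.restrict square := by
  rw [uniformTypes, ← Measure.restrict_pi_pi, volume_pi]
  congr 1
  exact pi_univ_Icc 0 1

theorem measurePreserving_uniformTypes :
    MeasurePreserving MeasurableEquiv.finTwoArrow uniformTypes
      ((volume.restrict (Icc (0 : ℝ) 1)).prod (volume.restrict (Icc (0 : ℝ) 1))) :=
  measurePreserving_finTwoArrow _

theorem uniformTypes_compl : uniformTypes squareᶜ = 0 := by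
  rw [uniformTypes_eq, Measure.restrict_apply isCompact_square.measurableSet.compl]
  simp

theorem muNeg_compl : muNeg squareᶜ = 0 := by
  simp [muNeg, uniformTypes_compl]

theorem measurable_edge_right : Measurable fun t : ℝ => (![1, t] : Fin 2 → ℝ) := by
  refine measurable_pi_iff.2 fun i => ?_
  fin_cases i <;> simp; fun_prop

theorem measurable_edge_top : Measurable fun t : ℝ => (![t, 1] : Fin 2 → ℝ) := by
  refine measurable_pi_iff.2 fun i => ?_
  fin_cases i <;> simp; fun_prop

theorem muPos_apply {A : Set (Fin 2 → ℝ)} (hA : MeasurableSet A) :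
    muPos A = A.indicator 1 0 + volume ({t | ![1, t] ∈ A} ∩ Icc (0 : ℝ) 1)
      + volume ({t | ![t, 1] ∈ A} ∩ Icc (0 : ℝ) 1) := by
  rw [muPos, Measure.add_apply, Measure.add_apply, Measure.dirac_apply' _ hA,
    Measure.map_apply measurable_edge_right hA, Measure.map_apply measurable_edge_top hA,
    Measure.restrict_apply (measurable_edge_right hA),
    Measure.restrict_apply (measurable_edge_top hA)]
  rfl

theorem muPos_compl : muPos squareᶜ = 0 := by
  have h1 : {t : ℝ | ![1, t] ∈ squareᶜ} ∩ Icc (0 : ℝ) 1 = ∅ := by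
    ext t; simp [mem_square]
  have h2 : {t : ℝ | ![t, 1] ∈ squareᶜ} ∩ Icc (0 : ℝ) 1 = ∅ := by
    ext t; simp [mem_square]
  rw [muPos_apply isCompact_square.measurableSet.compl, h1, h2]
  simp [mem_square]

theorem integral_mu {u : (Fin 2 → ℝ) → ℝ} (hu : ContinuousOn u square) :
    ∫ᵛ x, u x ∂<•mu = ∫ x, u x ∂muPos - ∫ x, u x ∂muNeg :=
  integral_toSignedMeasure_sub (integrable_of_continuousOn isCompact_square hu muPos_compl)
    (integrable_of_continuousOn isCompact_square hu muNeg_compl)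

theorem integral_muPos {u : (Fin 2 → ℝ) → ℝ} (hu : Continuous u) :
    ∫ x, u x ∂muPos = u 0 + (∫ t in (0 : ℝ)..1, u ![1, t]) + ∫ t in (0 : ℝ)..1, u ![t, 1] := by
  have hi : Integrable u muPos :=
    integrable_of_continuousOn isCompact_square hu.continuousOn muPos_compl
  rw [muPos] at hi ⊢
  obtain ⟨h12, h3⟩ := integrable_add_measure.1 hi
  obtain ⟨h1, h2⟩ := integrable_add_measure.1 h12
  rw [integral_add_measure h12 h3, integral_add_measure h1 h2, integral_dirac,
    integral_map measurable_edge_right.aemeasurable h2.1,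
    integral_map measurable_edge_top.aemeasurable h3.1,
    intervalIntegral.integral_of_le zero_le_one, intervalIntegral.integral_of_le zero_le_one,
    integral_Icc_eq_integral_Ioc, integral_Icc_eq_integral_Ioc]

theorem integral_muNeg (u : (Fin 2 → ℝ) → ℝ) :
    ∫ x, u x ∂muNeg = 3 * ∫ x, u x ∂uniformTypes := by
  rw [muNeg, integral_smul_nnreal_measure]
  simp [NNReal.smul_def]

/-! ### The price, the surplus function and its cells -/

theorem price_sq : price * price = 1 / 3 := by
  rw [price, div_mul_div_comm, Real.mul_self_sqrt (by norm_num)]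
  norm_num

theorem price_pos : 0 < price := by
  unfold price; positivity

theorem price_gt : 1 / 2 < price := by
  nlinarith [price_sq, price_pos]

theorem price_lt : price < 3 / 5 := by
  nlinarith [price_sq, price_pos]

theorem continuous_uStar : Continuous uStar := by
  unfold uStar; fun_prop

theorem uStar_zero : uStar 0 = 0 := by
  simp [uStar, price_pos.le]

/-- `uStar` is a maximum of three affine functions, and a piece supports it wherever that piece
attains the maximum. Conversely, one test point on the same piece suffices: the origin here, `(1,0)`
and `(0,1)` for the other cells. -/
theorem cell_noSale : cell square uStar ![0, 0] = noSale := by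
  have hp := price_pos
  ext x
  refine and_congr_right fun hx => ⟨fun h => ?_, fun h y _ => ?_⟩
  · have h0 := h 0 (by simp [mem_square])
    simp only [uStar_zero, dotProduct, Fin.sum_univ_two] at h0
    simp only [uStar, Matrix.cons_val_zero, Matrix.cons_val_one, zero_mul, add_zero, max_le_iff]
      at h0
    exact ⟨by linarith, by linarith⟩
  · have hx0 : uStar x = 0 := max_eq_left (max_le (by linarith [h.1]) (by linarith [h.2]))
    simp only [hx0, dotProduct, Fin.sum_univ_two]
    simp [uStar]

theorem cell_sellFirst : cell square uStar ![1, 0] = sellFirst := by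
  have hp := price_pos
  have hp1 := price_lt
  ext x
  refine and_congr_right fun hx => ⟨fun h => ?_, fun h y _ => ?_⟩
  · have h0 := h ![1, 0] (by simp [mem_square])
    have h1 : uStar ![1, 0] = 1 - price := by
      simp only [uStar, Matrix.cons_val_zero, Matrix.cons_val_one]
      rw [max_eq_left (a := 1 - price) (by linarith), max_eq_right (by linarith)]
    rw [h1] at h0
    simp only [dotProduct, Fin.sum_univ_two, Matrix.cons_val_zero, Matrix.cons_val_one,
      Pi.sub_apply] at h0
    have h2 : uStar x ≤ x 0 - price := by linarith
    simp only [uStar, max_le_iff] at h2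
    exact ⟨by linarith, by linarith⟩
  · have hx0 : uStar x = x 0 - price := by
      rw [uStar, max_eq_left (a := x 0 - price) (by linarith [h.2]),
        max_eq_right (by linarith [h.1])]
    have : y 0 - price ≤ uStar y := (le_max_left _ _).trans (le_max_right _ _)
    simp only [hx0, dotProduct, Fin.sum_univ_two, Matrix.cons_val_zero, Matrix.cons_val_one,
      Pi.sub_apply]
    linarith

theorem cell_sellSecond : cell square uStar ![0, 1] = sellSecond := by
  have hp := price_pos
  have hp1 := price_lt
  ext x
  refine and_congr_right fun hx => ⟨fun h => ?_, fun h y _ => ?_⟩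
  · have h0 := h ![0, 1] (by simp [mem_square])
    have h1 : uStar ![0, 1] = 1 - price := by
      simp only [uStar, Matrix.cons_val_zero, Matrix.cons_val_one]
      rw [max_eq_right (b := 1 - price) (by linarith), max_eq_right (by linarith)]
    rw [h1] at h0
    simp only [dotProduct, Fin.sum_univ_two, Matrix.cons_val_zero, Matrix.cons_val_one,
      Pi.sub_apply] at h0
    have h2 : uStar x ≤ x 1 - price := by linarith
    simp only [uStar, max_le_iff] at h2
    exact ⟨by linarith, by linarith⟩
  · have hx0 : uStar x = x 1 - price := by
      rw [uStar, max_eq_right (b := x 1 - price) (by linarith [h.2]),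
        max_eq_right (by linarith [h.1])]
    have : y 1 - price ≤ uStar y := (le_max_right _ _).trans (le_max_right _ _)
    simp only [hx0, dotProduct, Fin.sum_univ_two, Matrix.cons_val_zero, Matrix.cons_val_one,
      Pi.sub_apply]
    linarith

theorem cover_square : noSale ∪ sellFirst ∪ sellSecond = square := by
  ext x
  simp only [noSale, sellFirst, sellSecond, mem_union, mem_ofPred_eq]
  rcases le_total (x 0) price with h0 | h0 <;> rcases le_total (x 1) price with h1 | h1 <;>
    rcases le_total (x 0) (x 1) with h2 | h2 <;> grind

theorem uStar_mem_surplusFunctions : uStar ∈ surplusFunctions square atMostOne := by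
  have h : ∀ x ∈ square, ∃ s ∈ atMostOne, s ∈ subgradients square uStar x := fun x hx => by
    rw [← cover_square] at hx
    rcases hx with (hx | hx) | hx
    · exact ⟨![0, 0], by simp [atMostOne], (cell_noSale ▸ hx : x ∈ cell _ _ _).2⟩
    · exact ⟨![1, 0], by simp [atMostOne], (cell_sellFirst ▸ hx : x ∈ cell _ _ _).2⟩
    · exact ⟨![0, 1], by simp [atMostOne], (cell_sellSecond ▸ hx : x ∈ cell _ _ _).2⟩
  exact ⟨convexOn_of_subgradients convex_square fun x hx => (h x hx).imp fun _ => And.right, h⟩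

/-! ### Implementations of the menu -/

theorem forall_mem_eitherItemMenu {p : (Fin 2 → ℝ) × ℝ → Prop} :
    (∀ o ∈ eitherItemMenu, p o) ↔ p (![0, 0], 0) ∧ p (![1, 0], price) ∧ p (![0, 1], price) := by
  simp [eitherItemMenu]

theorem eitherItem_implements : eitherItem.Implements square eitherItemMenu := by
  intro x _
  rw [forall_mem_eitherItemMenu]
  by_cases h : max (x 0) (x 1) < price
  · have h' := max_lt_iff.1 h
    simp only [Mechanism.surplus, eitherItem, if_pos h, eitherItemMenu]
    simp [dotProduct, Fin.sum_univ_two, h'.1.le, h'.2.le]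
  · have h' := le_max_iff.1 (not_lt.1 h)
    by_cases h1 : x 1 ≤ x 0
    · simp only [Mechanism.surplus, eitherItem, if_neg h, if_pos h1, eitherItemMenu]
      simp [dotProduct, Fin.sum_univ_two]
      grind
    · simp only [Mechanism.surplus, eitherItem, if_neg h, if_neg h1, eitherItemMenu]
      simp [dotProduct, Fin.sum_univ_two]
      grind

theorem Mechanism.Implements.truthful {n : ℕ} {X : Set (Fin n → ℝ)}
    {menu : Set ((Fin n → ℝ) × ℝ)} {M : Mechanism n} (h : M.Implements X menu) : M.Truthful X :=
  fun x hx y hy => (h x hx).2 _ (h y hy).1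

theorem implements_feasible {M : Mechanism 2} (h : M.Implements square eitherItemMenu) :
    M.Feasible square atMostOne := by
  intro x hx
  have key : ∀ o ∈ eitherItemMenu, o.1 ∈ atMostOne := by
    rw [forall_mem_eitherItemMenu]
    simp [atMostOne]
  exact key _ (h x hx).1

/-- The surplus is the maximum of the three option values, so tie-breaking does not affect it. -/
theorem implements_surplus {M : Mechanism 2} (h : M.Implements square eitherItemMenu)
    {x : Fin 2 → ℝ} (hx : x ∈ square) : M.surplus x = uStar x := by
  obtain ⟨h1, h2⟩ := h x hx
  apply le_antisymm
  · have key : ∀ o ∈ eitherItemMenu, o.1 ⬝ᵥ x - o.2 ≤ uStar x := by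
      rw [forall_mem_eitherItemMenu]
      simp [dotProduct, Fin.sum_univ_two, uStar]
    exact key _ h1
  · rw [forall_mem_eitherItemMenu] at h2
    simp only [dotProduct, Fin.sum_univ_two, Matrix.cons_val_zero, Matrix.cons_val_one] at h2
    exact max_le (by linarith [h2.1]) (max_le (by linarith [h2.2.1]) (by linarith [h2.2.2]))

theorem uStar_nonneg (x : Fin 2 → ℝ) : 0 ≤ uStar x := le_max_left _ _

/-! ### The strip mass -/

theorem continuous_stripMass : Continuous stripMass := by
  unfold stripMass
  refine Continuous.if_le (by fun_prop) (by fun_prop) continuous_id continuous_const ?_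
  rintro a rfl
  -- The two branches agree at `price` exactly because `price ^ 2 = 1 / 3`.
  nlinarith [price_sq]

theorem stripMass_zero : stripMass 0 = 0 := by
  simp [stripMass, price_pos.le]

theorem stripMass_one : stripMass 1 = 1 := by
  rw [stripMass, if_neg (by linarith [price_lt])]
  norm_num

theorem strictMonoOn_stripMass : StrictMonoOn stripMass (Icc 0 1) := by
  have hp := price_lt
  have hs := price_sq
  intro a ha b hb hab
  obtain ⟨-, hb⟩ := hb
  unfold stripMass
  split_ifs with h1 h2 h2
  · nlinarith
  · have : 3 * (1 - price) * a ≤ 1 - 3 / 2 * (1 - price) ^ 2 := by nlinarith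
    nlinarith
  · linarith
  · nlinarith

theorem stripMass_mem_Icc {a : ℝ} (ha : a ∈ Icc (0 : ℝ) 1) : stripMass a ∈ Icc (0 : ℝ) 1 := by
  have h := strictMonoOn_stripMass.monotoneOn
  constructor
  · simpa [stripMass_zero] using h (by simp) ha ha.1
  · simpa [stripMass_one] using h ha (by simp) ha.2

/-- This inequality makes the matching tight: it keeps the gain in the second coordinate below the
gain in the first. The linear branch has slope `3 * (1 - price) > 1`; on the other branch the claim
amounts to `3 / 2 * (1 - a) ≤ 1` for `a < 1`, which holds since `a > 1 / 2`. -/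
theorem le_stripMass {a : ℝ} (ha : a ∈ Icc (0 : ℝ) 1) : a ≤ stripMass a := by
  have hp := price_lt
  have hp' := price_gt
  obtain ⟨h0, h1⟩ := ha
  unfold stripMass
  split_ifs with h
  · nlinarith
  · nlinarith

/-- `min x a` is the length of the section of the strip `y 0 - y 1 ≤ a` of `sellFirst` at first
coordinate `x`. -/
theorem integral_min_eq_stripMass {a : ℝ} (ha : a ∈ Icc (0 : ℝ) 1) :
    3 * ∫ x in price..1, min x a = stripMass a := by
  have hp := price_lt
  have hs := price_sq
  have hI : ∀ b c : ℝ, IntervalIntegrable (fun x => min x a) volume b c := fun b c =>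
    Continuous.intervalIntegrable (by fun_prop) b c
  have hconst : ∀ b ≤ 1, a ≤ b → ∫ x in b..1, min x a = (1 - b) * a := fun b hb hab => by
    rw [intervalIntegral.integral_congr (g := fun _ => a)]
    · simp
    · intro x hx
      rw [uIcc_of_le hb] at hx
      exact min_eq_right (hab.trans hx.1)
  unfold stripMass
  split_ifs with h
  · rw [hconst _ (by linarith) h]
    ring
  · rw [← intervalIntegral.integral_add_adjacent_intervals (hI price a) (hI a 1),
      hconst a ha.2 le_rfl, intervalIntegral.integral_congr (g := fun x => x)]
    · rw [integral_id]
      nlinarith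
    · intro x hx
      rw [uIcc_of_le (by linarith)] at hx
      exact min_eq_left hx.2

/-! ### Revenue -/

theorem integral_uniformTypes (f : (Fin 2 → ℝ) → ℝ) (hf : Integrable f uniformTypes) :
    ∫ x, f x ∂uniformTypes = ∫ a in (0 : ℝ)..1, ∫ b in (0 : ℝ)..1, f ![a, b] := by
  have e := measurePreserving_uniformTypes.symm
  rw [← e.integral_comp' f, integral_prod]
  · simp only [intervalIntegral.integral_of_le zero_le_one, integral_Icc_eq_integral_Ioc]
    rfl
  · exact e.integrable_comp_emb (MeasurableEquiv.measurableEmbedding _) |>.2 hf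

theorem integral_uniformTypes_symm (f : (Fin 2 → ℝ) → ℝ) (hf : Integrable f uniformTypes) :
    ∫ x, f x ∂uniformTypes = ∫ b in (0 : ℝ)..1, ∫ a in (0 : ℝ)..1, f ![a, b] := by
  have e := measurePreserving_uniformTypes.symm
  rw [← e.integral_comp' f, integral_prod_symm]
  · simp only [intervalIntegral.integral_of_le zero_le_one, integral_Icc_eq_integral_Ioc]
    rfl
  · exact e.integrable_comp_emb (MeasurableEquiv.measurableEmbedding _) |>.2 hf

/-- Integration by parts for absolutely continuous functions. The factor `t` kills the boundary term
at 0, which is why `muPos` has no mass on the edges through the origin apart from the origin itself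
and edge endpoints. -/
theorem integral_id_mul_deriv {g : ℝ → ℝ} {K : ℝ≥0} (hg : LipschitzWith K g) :
    ∫ t in (0 : ℝ)..1, t * deriv g t = g 1 - ∫ t in (0 : ℝ)..1, g t := by
  have h := AbsolutelyContinuousOnInterval.integral_mul_deriv_eq_deriv_mul
    (a := 0) (b := 1) (f := fun t : ℝ => t) (g := g)
    (LipschitzWith.id.lipschitzOnWith (s := uIcc 0 1)).absolutelyContinuousOnInterval
    (hg.lipschitzOnWith (s := uIcc 0 1)).absolutelyContinuousOnInterval
  simpa using h

theorem lipschitzWith_vec (a : ℝ) :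
    LipschitzWith 1 (fun t : ℝ => (![a, t] : Fin 2 → ℝ)) ∧
      LipschitzWith 1 (fun t : ℝ => (![t, a] : Fin 2 → ℝ)) := by
  constructor <;>
  · refine LipschitzWith.of_dist_le_mul fun s t => (dist_pi_le_iff (by positivity)).2 fun i => ?_
    fin_cases i <;> simp

section FDeriv

variable {v : (Fin 2 → ℝ) → ℝ} {K : ℝ≥0}

theorem integrable_coord_mul_fderiv (hv : LipschitzWith K v) (i : Fin 2) :
    Integrable (fun x => x i * fderiv ℝ v x (Pi.single i 1)) uniformTypes := by
  refine Integrable.of_bound (C := K) ?_ ?_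
  · exact ((measurable_pi_apply i).mul
      (measurable_fderiv_apply_const ℝ v _)).aestronglyMeasurable
  · have hm : ∀ᵐ x ∂uniformTypes, x ∈ square := mem_ae_iff.2 uniformTypes_compl
    filter_upwards [hm] with x hx
    have h1 : ‖x i‖ ≤ 1 := by
      rw [mem_square] at hx
      rw [Real.norm_eq_abs, abs_le]
      fin_cases i <;> simp <;> constructor <;> linarith [hx.1.1, hx.1.2, hx.2.1, hx.2.2]
    have h2 : ‖fderiv ℝ v x (Pi.single i 1)‖ ≤ K := by
      refine ((fderiv ℝ v x).le_opNorm _).trans ?_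
      rw [Pi.norm_single, norm_one, mul_one]
      exact norm_fderiv_le_of_lipschitz ℝ hv
    rw [norm_mul]
    nlinarith [norm_nonneg (x i), norm_nonneg (fderiv ℝ v x (Pi.single i 1))]

theorem ae_differentiableAt_uniformTypes (hv : LipschitzWith K v) :
    ∀ᵐ x ∂uniformTypes, DifferentiableAt ℝ v x := by
  rw [uniformTypes_eq]
  exact ae_restrict_of_ae hv.ae_differentiableAt

theorem deriv_line_eq {x : Fin 2 → ℝ} (hx : DifferentiableAt ℝ v x) :
    deriv (fun t => v ![t, x 1]) (x 0) = fderiv ℝ v x (Pi.single 0 1) ∧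
      deriv (fun t => v ![x 0, t]) (x 1) = fderiv ℝ v x (Pi.single 1 1) := by
  have hx0 : ![x 0, x 1] = x := by ext i; fin_cases i <;> rfl
  constructor
  · refine HasDerivAt.deriv ?_
    have h : HasDerivAt (fun t : ℝ => (![t, x 1] : Fin 2 → ℝ)) (Pi.single 0 1) (x 0) := by
      refine hasDerivAt_pi.2 fun i => ?_
      fin_cases i
      · exact hasDerivAt_id' (x 0)
      · simpa using hasDerivAt_const (x 0) (x 1)
    refine HasFDerivAt.comp_hasDerivAt (x 0) ?_ h
    rw [hx0]
    exact hx.hasFDerivAt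
  · refine HasDerivAt.deriv ?_
    have h : HasDerivAt (fun t : ℝ => (![x 0, t] : Fin 2 → ℝ)) (Pi.single 1 1) (x 1) := by
      refine hasDerivAt_pi.2 fun i => ?_
      fin_cases i
      · simpa using hasDerivAt_const (x 1) (x 0)
      · exact hasDerivAt_id' (x 1)
    refine HasFDerivAt.comp_hasDerivAt (x 1) ?_ h
    rw [hx0]
    exact hx.hasFDerivAt

/-- Fubini with the differentiated variable innermost reduces each identity to integration by parts
on lines. -/
theorem integral_coord_mul_fderiv (hv : LipschitzWith K v) :
    ∫ x, x 0 * fderiv ℝ v x (Pi.single 0 1) ∂uniformTypes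
        = (∫ t in (0 : ℝ)..1, v ![1, t]) - ∫ x, v x ∂uniformTypes ∧
      ∫ x, x 1 * fderiv ℝ v x (Pi.single 1 1) ∂uniformTypes
        = (∫ t in (0 : ℝ)..1, v ![t, 1]) - ∫ x, v x ∂uniformTypes := by
  have hvi : Integrable v uniformTypes :=
    integrable_of_continuousOn isCompact_square hv.continuous.continuousOn uniformTypes_compl
  have hd := ae_differentiableAt_uniformTypes hv
  have hcont : Continuous fun p : ℝ × ℝ => v ![p.1, p.2] := by
    refine hv.continuous.comp (continuous_pi fun i => ?_)
    fin_cases i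
    · exact continuous_fst
    · exact continuous_snd
  constructor
  · have hae : (fun x => x 0 * fderiv ℝ v x (Pi.single 0 1)) =ᵐ[uniformTypes]
        fun x => x 0 * deriv (fun t => v ![t, x 1]) (x 0) := by
      filter_upwards [hd] with x hx
      rw [(deriv_line_eq hx).1]
    rw [integral_congr_ae hae, integral_uniformTypes_symm _
      ((integrable_coord_mul_fderiv hv 0).congr hae), integral_uniformTypes_symm v hvi,
      ← intervalIntegral.integral_sub]
    · refine intervalIntegral.integral_congr fun b _ => ?_
      exact integral_id_mul_deriv (hv.comp (lipschitzWith_vec b).2)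
    · exact Continuous.intervalIntegrable
        (hv.continuous.comp (lipschitzWith_vec 1).1.continuous) 0 1
    · exact (intervalIntegral.continuous_parametric_intervalIntegral_of_continuous'
        (f := fun b a => v ![a, b]) (hcont.comp continuous_swap) 0 1).intervalIntegrable 0 1
  · have hae : (fun x => x 1 * fderiv ℝ v x (Pi.single 1 1)) =ᵐ[uniformTypes]
        fun x => x 1 * deriv (fun t => v ![x 0, t]) (x 1) := by
      filter_upwards [hd] with x hx
      rw [(deriv_line_eq hx).2]
    rw [integral_congr_ae hae, integral_uniformTypes _
      ((integrable_coord_mul_fderiv hv 1).congr hae), integral_uniformTypes v hvi,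
      ← intervalIntegral.integral_sub]
    · refine intervalIntegral.integral_congr fun b _ => ?_
      exact integral_id_mul_deriv (hv.comp (lipschitzWith_vec b).1)
    · exact Continuous.intervalIntegrable
        (hv.continuous.comp (lipschitzWith_vec 1).2.continuous) 0 1
    · exact (intervalIntegral.continuous_parametric_intervalIntegral_of_continuous'
        (f := fun a b => v ![a, b]) hcont 0 1).intervalIntegrable 0 1

end FDeriv

/-- The frontier of a convex set is Lebesgue null. -/
theorem ae_square_mem_nhds : ∀ᵐ x ∂uniformTypes, square ∈ nhds x := by
  have h : ∀ᵐ x ∂uniformTypes, x ∈ interior square := by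
    rw [uniformTypes_eq, ae_restrict_iff' isCompact_square.measurableSet]
    have := convex_square.addHaar_frontier (volume : Measure (Fin 2 → ℝ))
    filter_upwards [mem_ae_iff.2 (by rwa [compl_compl] : volume (frontier square)ᶜᶜ = 0)]
      with x hx hxs
    by_contra hxi
    exact hx ⟨subset_closure hxs, hxi⟩
  filter_upwards [h] with x hx using mem_interior_iff_mem_nhds.1 hx

/-- The revenue of a feasible truthful mechanism in terms of its surplus function. -/
theorem revenue_eq {M : Mechanism 2} (hF : M.Feasible square atMostOne)
    (hT : M.Truthful square) :
    Integrable M.pay uniformTypes ∧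
      M.revenue uniformTypes = (∫ᵛ x, M.surplus x ∂<•mu) - M.surplus 0 := by
  have hlip := lipschitzOnWith_of_mem_surplusFunctions
    (M.surplus_mem_surplusFunctions convex_square hF hT)
  -- The surplus is controlled only on the square; a global Lipschitz extension has a derivative
  -- almost everywhere by Rademacher.
  obtain ⟨v, hv, huv⟩ := hlip.extend_real
  have hvi : Integrable v uniformTypes :=
    integrable_of_continuousOn isCompact_square hv.continuous.continuousOn uniformTypes_compl
  have hpay : (fun x => x 0 * fderiv ℝ v x (Pi.single 0 1)
      + x 1 * fderiv ℝ v x (Pi.single 1 1) - v x) =ᵐ[uniformTypes] M.pay := by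
    filter_upwards [ae_differentiableAt_uniformTypes hv, ae_square_mem_nhds] with x hx hn
    have hxs : x ∈ square := mem_of_mem_nhds hn
    have hsub : M.alloc x ∈ subgradients square v x := fun y hy => by
      rw [← huv hy, ← huv hxs]
      exact hT.alloc_mem_subgradients hxs y hy
    rw [fderiv_eq_dotProduct hn hx hsub, fderiv_eq_dotProduct hn hx hsub, ← huv hxs,
      dotProduct_single, dotProduct_single]
    simp only [mul_one, Mechanism.surplus, dotProduct, Fin.sum_univ_two]
    ring
  have i0 := integrable_coord_mul_fderiv hv 0
  have i1 := integrable_coord_mul_fderiv hv 1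
  refine ⟨((i0.add i1).sub hvi).congr hpay, ?_⟩
  have hae : ∀ {ν : Measure (Fin 2 → ℝ)}, ν squareᶜ = 0 →
      ∫ x, M.surplus x ∂ν = ∫ x, v x ∂ν := fun {ν} hν =>
    integral_congr_ae <| by
      have hm : ∀ᵐ x ∂ν, x ∈ square := mem_ae_iff.2 hν
      filter_upwards [hm] with x hx using huv hx
  -- Each of the two parts formulas contributes `-∫ v` and the payment a third, giving the mass 3 of
  -- `muNeg`. The unit atom of `muPos` at the origin is offset by subtracting `surplus 0`.
  rw [Mechanism.revenue, ← integral_congr_ae hpay, integral_sub (by exact i0.add i1) hvi,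
    integral_add i0 i1, (integral_coord_mul_fderiv hv).1, (integral_coord_mul_fderiv hv).2,
    integral_mu hlip.continuousOn, hae muPos_compl, hae muNeg_compl,
    integral_muPos hv.continuous, integral_muNeg, huv (by simp [mem_square] : (0 : Fin 2 → ℝ) ∈ _)]
  ring

/-! ### The negative part of the transformed measure -/

theorem continuous_coord (i : Fin 2) : Continuous fun x : Fin 2 → ℝ => x i := continuous_apply i

theorem measurableSet_noSale : MeasurableSet noSale :=
  isCompact_square.measurableSet.inter
    ((isClosed_le (continuous_coord 0) continuous_const).inter
      (isClosed_le (continuous_coord 1) continuous_const)).measurableSet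

theorem measurableSet_sellFirst : MeasurableSet sellFirst :=
  isCompact_square.measurableSet.inter
    ((isClosed_le continuous_const (continuous_coord 0)).inter
      (isClosed_le (continuous_coord 1) (continuous_coord 0))).measurableSet

theorem measurableSet_sellSecond : MeasurableSet sellSecond :=
  isCompact_square.measurableSet.inter
    ((isClosed_le continuous_const (continuous_coord 1)).inter
      (isClosed_le (continuous_coord 0) (continuous_coord 1))).measurableSet

/-- Exchanging the two items. -/
def exchange (x : Fin 2 → ℝ) : Fin 2 → ℝ := ![x 1, x 0]

theorem measurePreserving_exchange : MeasurePreserving exchange muNeg muNeg := by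
  have e := measurePreserving_uniformTypes
  have h : MeasurePreserving exchange uniformTypes uniformTypes :=
    e.symm.comp (Measure.measurePreserving_swap.comp e)
  refine ⟨h.measurable, ?_⟩
  rw [muNeg, Measure.map_smul, h.map_eq]

theorem preimage_exchange_sellFirst : exchange ⁻¹' sellFirst = sellSecond := by
  ext x
  simp only [exchange, sellFirst, sellSecond, mem_preimage, mem_ofPred_eq, mem_square,
    Matrix.cons_val_zero, Matrix.cons_val_one]
  tauto

/-- The mass of a set, by sections along the second coordinate. -/
theorem muNeg_apply {A : Set (Fin 2 → ℝ)} (hA : MeasurableSet A) :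
    muNeg A = 3 * ∫⁻ a in Icc (0 : ℝ) 1, volume ({b | ![a, b] ∈ A} ∩ Icc (0 : ℝ) 1) := by
  have e := measurePreserving_uniformTypes
  have h := e.symm.measure_preimage_equiv A
  have hA' : MeasurableSet (MeasurableEquiv.finTwoArrow.symm ⁻¹' A) :=
    MeasurableEquiv.finTwoArrow.symm.measurable hA
  rw [Measure.prod_apply hA'] at h
  rw [muNeg, Measure.smul_apply, ← h, ENNReal.smul_def, smul_eq_mul]
  congr 1
  refine lintegral_congr fun a => ?_
  rw [Measure.restrict_apply (measurable_prodMk_left hA')]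
  rfl

theorem muNeg_strip {a : ℝ} (ha : a ∈ Icc (0 : ℝ) 1) :
    muNeg ({y | y 0 - y 1 ≤ a} ∩ sellFirst) = ENNReal.ofReal (stripMass a) := by
  have hp := price_pos
  have hp1 := price_lt
  have hm : MeasurableSet ({y : Fin 2 → ℝ | y 0 - y 1 ≤ a} ∩ sellFirst) :=
    (isClosed_le ((continuous_coord 0).sub (continuous_coord 1))
      continuous_const).measurableSet.inter measurableSet_sellFirst
  have hsec : ∀ x ∈ Icc (0 : ℝ) 1,
      volume ({b | ![x, b] ∈ {y : Fin 2 → ℝ | y 0 - y 1 ≤ a} ∩ sellFirst} ∩ Icc (0 : ℝ) 1)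
        = (Icc price 1).indicator (fun x => ENNReal.ofReal (min x a)) x := fun x hx => by
    by_cases hxp : price ≤ x
    · rw [indicator_of_mem (mem_Icc.2 ⟨hxp, hx.2⟩)]
      have : {b | ![x, b] ∈ {y : Fin 2 → ℝ | y 0 - y 1 ≤ a} ∩ sellFirst} ∩ Icc (0 : ℝ) 1
          = Icc (max 0 (x - a)) x := by
        ext b
        simp only [sellFirst, mem_inter_iff, mem_ofPred_eq, mem_square, Matrix.cons_val_zero,
          Matrix.cons_val_one, mem_Icc, max_le_iff] at hx ⊢
        constructor
        · rintro ⟨⟨h1, -, -, h2⟩, h3, h4⟩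
          exact ⟨⟨h3, by linarith⟩, h2⟩
        · rintro ⟨⟨h1, h2⟩, h3⟩
          have hb : b ≤ 1 := h3.trans hx.2
          exact ⟨⟨by linarith, ⟨hx, h1, hb⟩, hxp, h3⟩, h1, hb⟩
      rw [this, Real.volume_Icc]
      congr 1
      rcases le_total x a with h | h
      · rw [max_eq_left (by linarith), min_eq_left h, sub_zero]
      · rw [max_eq_right (by linarith), min_eq_right h]
        ring
    · rw [indicator_of_notMem fun h => hxp h.1]
      convert measure_empty (μ := volume)
      ext b
      simp [sellFirst, hxp]
  rw [muNeg_apply hm, setLIntegral_congr_fun measurableSet_Icc hsec,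
    setLIntegral_indicator measurableSet_Icc, inter_eq_left.2 (Icc_subset_Icc_left hp.le),
    ← ofReal_integral_eq_lintegral_ofReal, integral_Icc_eq_integral_Ioc,
    ← intervalIntegral.integral_of_le (by linarith), ← integral_min_eq_stripMass ha,
    ENNReal.ofReal_mul (by norm_num)]
  · simp
  · exact (Continuous.continuousOn (by fun_prop)).integrableOn_Icc
  · filter_upwards [ae_restrict_mem measurableSet_Icc] with x hx
    exact le_min (hp.le.trans hx.1) ha.1

theorem diff_mem_Icc {y : Fin 2 → ℝ} (hy : y ∈ sellFirst) : y 0 - y 1 ∈ Icc (0 : ℝ) 1 := by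
  obtain ⟨h, -, h2⟩ := hy
  rw [mem_square] at h
  constructor <;> linarith [h.1.2, h.2.1]

theorem muNeg_sellFirst : muNeg sellFirst = 1 := by
  have h := muNeg_strip (a := 1) (by simp)
  have hsub : sellFirst ⊆ {y | y 0 - y 1 ≤ 1} := fun y hy => (diff_mem_Icc hy).2
  rwa [inter_eq_right.2 hsub, stripMass_one, ENNReal.ofReal_one] at h

theorem muNeg_sellSecond : muNeg sellSecond = 1 := by
  rw [← preimage_exchange_sellFirst, measurePreserving_exchange.measure_preimage
    measurableSet_sellFirst.nullMeasurableSet, muNeg_sellFirst]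

theorem muNeg_noSale : muNeg noSale = 1 := by
  have hp := price_pos
  have hp1 := price_lt
  have h : noSale = Icc 0 (fun _ => price) ∩ square := by
    ext x
    simp only [noSale, mem_ofPred_eq, mem_inter_iff, mem_Icc, Pi.le_def, Fin.forall_fin_two,
      mem_square, Pi.zero_apply]
    tauto
  have h2 : Icc 0 (fun _ => price) ⊆ square :=
    Icc_subset_Icc_right fun _ => by simp only [Pi.one_apply]; linarith
  rw [muNeg, Measure.smul_apply, uniformTypes_eq, Measure.restrict_apply measurableSet_noSale, h,
    inter_assoc, inter_self, inter_eq_left.2 h2, Real.volume_Icc_pi]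
  simp only [Pi.zero_apply, sub_zero, Fin.prod_univ_two]
  rw [← ENNReal.ofReal_mul hp.le, price_sq, ENNReal.smul_def, smul_eq_mul]
  rw [one_div, ENNReal.ofReal_inv_of_pos (by norm_num)]
  simpa using ENNReal.mul_inv_cancel (a := 3) (by norm_num) (by norm_num)

/-- The difference of the values in `sellFirst`, rearranged by `stripMass`, is uniform. -/
theorem map_stripMass_sellFirst :
    (muNeg.restrict sellFirst).map (fun y => stripMass (y 0 - y 1))
      = volume.restrict (Icc (0 : ℝ) 1) := by
  have hm : Measurable fun y : Fin 2 → ℝ => stripMass (y 0 - y 1) :=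
    (continuous_stripMass.comp ((continuous_coord 0).sub (continuous_coord 1))).measurable
  refine Measure.ext_of_Iic _ _ fun b => ?_
  rw [Measure.map_apply hm measurableSet_Iic, Measure.restrict_apply (hm measurableSet_Iic),
    Measure.restrict_apply measurableSet_Iic]
  rcases lt_or_ge b 0 with hb | hb
  · rw [(_ : Iic b ∩ Icc (0 : ℝ) 1 = ∅), (_ : _ ∩ sellFirst = ∅)]
    · simp
    · ext y
      simp only [mem_inter_iff, mem_preimage, mem_Iic, mem_empty_iff_false, iff_false, not_and]
      intro h hy
      linarith [(stripMass_mem_Icc (diff_mem_Icc hy)).1]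
    · ext y
      simp only [mem_inter_iff, mem_Icc, mem_Iic, mem_empty_iff_false, iff_false]
      intro h
      linarith [h.1, h.2.1]
  -- `a` is a quantile: strict monotonicity of `stripMass` turns the event `stripMass (y 0 - y 1) ≤
  -- b` into the strip `y 0 - y 1 ≤ a`, whose mass is known.
  · obtain ⟨a, ha, hab⟩ : min b 1 ∈ stripMass '' Icc 0 1 := by
      refine intermediate_value_Icc zero_le_one continuous_stripMass.continuousOn ?_
      rw [stripMass_zero, stripMass_one]
      exact ⟨le_min hb zero_le_one, min_le_right _ _⟩
    have h1 : (fun y : Fin 2 → ℝ => stripMass (y 0 - y 1)) ⁻¹' Iic b ∩ sellFirst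
        = {y | y 0 - y 1 ≤ a} ∩ sellFirst := by
      ext y
      refine and_congr_left fun hy => ?_
      have hd := diff_mem_Icc hy
      rw [mem_preimage, mem_Iic, mem_ofPred_eq, ← strictMonoOn_stripMass.le_iff_le hd ha, hab,
        le_min_iff, and_iff_left (stripMass_mem_Icc hd).2]
    have h2 : Iic b ∩ Icc (0 : ℝ) 1 = Icc 0 (min b 1) := by
      ext y
      simp only [mem_inter_iff, mem_Icc, mem_Iic, le_min_iff]
      tauto
    rw [h1, h2, muNeg_strip ha, Real.volume_Icc, hab, sub_zero]

/-- The reflection `t ↦ 1 - t` preserves the uniform law. It sends the diagonal of the cell to the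
corner `(1,1)`. -/
theorem map_one_sub_stripMass_sellFirst :
    (muNeg.restrict sellFirst).map (fun y => 1 - stripMass (y 0 - y 1))
      = volume.restrict (Icc (0 : ℝ) 1) := by
  have hm : Measurable fun y : Fin 2 → ℝ => stripMass (y 0 - y 1) :=
    (continuous_stripMass.comp ((continuous_coord 0).sub (continuous_coord 1))).measurable
  have h := (Measure.measurePreserving_sub_left (volume : Measure ℝ) 1).restrict_preimage
    (measurableSet_Icc (a := (0 : ℝ)) (b := 1))
  simp only [preimage_const_sub_Icc, sub_self, sub_zero] at h
  rw [← h.map_eq, ← map_stripMass_sellFirst, Measure.map_map h.measurable hm]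
  rfl

theorem map_one_sub_stripMass_sellSecond :
    (muNeg.restrict sellSecond).map (fun y => 1 - stripMass (y 1 - y 0))
      = volume.restrict (Icc (0 : ℝ) 1) := by
  have hm : Measurable fun y : Fin 2 → ℝ => 1 - stripMass (y 0 - y 1) :=
    ((continuous_stripMass.comp
      ((continuous_coord 0).sub (continuous_coord 1))).measurable).const_sub 1
  have h := measurePreserving_exchange.restrict_preimage measurableSet_sellFirst
  rw [preimage_exchange_sellFirst] at h
  rw [← map_one_sub_stripMass_sellFirst, ← h.map_eq, Measure.map_map hm h.measurable]
  rfl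

/-- Overlaps of cells lie on the lines `x 0 = price`, `x 1 = price` and the diagonal. -/
theorem muNeg_inter :
    muNeg (noSale ∩ sellFirst) = 0 ∧ muNeg ((noSale ∪ sellFirst) ∩ sellSecond) = 0 := by
  have hx : ∀ c : ℝ, muNeg {x | x 0 = c} = 0 := fun c => by
    rw [muNeg, Measure.smul_apply, uniformTypes, Measure.pi_hyperplane, smul_zero]
  have hy : ∀ c : ℝ, muNeg {x | x 1 = c} = 0 := fun c => by
    rw [muNeg, Measure.smul_apply, uniformTypes, Measure.pi_hyperplane, smul_zero]
  have hd : muNeg {x | x 1 = x 0} = 0 := by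
    rw [muNeg_apply (isClosed_eq (continuous_coord 1) (continuous_coord 0)).measurableSet]
    have : ∀ a : ℝ, volume ({b : ℝ | ![a, b] ∈ {x : Fin 2 → ℝ | x 1 = x 0}} ∩ Icc (0 : ℝ) 1) = 0 :=
      fun a => measure_mono_null (t := {a}) (fun b hb => hb.1) (by simp)
    simp only [this, lintegral_zero, mul_zero]
  constructor
  · exact measure_mono_null (fun x hx => le_antisymm hx.1.2.1 hx.2.2.1) (hx price)
  · refine measure_mono_null (t := {x | x 1 = price} ∪ {x | x 1 = x 0}) ?_
      (measure_union_null (hy price) hd)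
    rintro x ⟨h | h, h'⟩
    · exact Or.inl (le_antisymm h.2.2 h'.2.1)
    · exact Or.inr (le_antisymm h.2.2 h'.2.2)

theorem muNeg_restrict_cells :
    muNeg.restrict noSale + muNeg.restrict sellFirst + muNeg.restrict sellSecond = muNeg := by
  rw [← Measure.restrict_union₀ muNeg_inter.1 measurableSet_sellFirst.nullMeasurableSet,
    ← Measure.restrict_union₀ muNeg_inter.2 measurableSet_sellSecond.nullMeasurableSet,
    cover_square]
  exact Measure.restrict_eq_self_of_ae_mem (mem_ae_iff.2 muNeg_compl)

/-! ### Masses of the cells -/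

theorem mu_apply_eq_zero {A : Set (Fin 2 → ℝ)} (hA : MeasurableSet A) (h1 : muPos A = 1)
    (h2 : muNeg A = 1) : mu A = 0 := by
  rw [mu, Measure.toSignedMeasure_sub_apply hA, Measure.real, Measure.real, h1, h2, sub_self]

theorem mu_noSale : mu noSale = 0 := by
  have hp := price_pos
  have hp1 : ¬ 1 ≤ price := by linarith [price_lt]
  refine mu_apply_eq_zero measurableSet_noSale ?_ muNeg_noSale
  rw [muPos_apply measurableSet_noSale]
  simp [noSale, mem_square, hp.le, hp1]

theorem mu_sellFirst : mu sellFirst = 0 := by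
  have hp := price_pos
  refine mu_apply_eq_zero measurableSet_sellFirst ?_ muNeg_sellFirst
  have h1 : {t : ℝ | ![1, t] ∈ sellFirst} ∩ Icc (0 : ℝ) 1 = Icc 0 1 := by
    ext t
    have hp1 : price ≤ 1 := by linarith [price_lt]
    simp [sellFirst, mem_square, hp1]
  have h2 : volume ({t : ℝ | ![t, 1] ∈ sellFirst} ∩ Icc (0 : ℝ) 1) = 0 := by
    refine measure_mono_null (t := {1}) (fun t ht => ?_) (by simp)
    exact le_antisymm ht.2.2 ht.1.2.2
  rw [muPos_apply measurableSet_sellFirst, h1, h2]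
  simp [sellFirst, hp]

theorem mu_sellSecond : mu sellSecond = 0 := by
  have hp := price_pos
  refine mu_apply_eq_zero measurableSet_sellSecond ?_ muNeg_sellSecond
  have h1 : {t : ℝ | ![t, 1] ∈ sellSecond} ∩ Icc (0 : ℝ) 1 = Icc 0 1 := by
    ext t
    have hp1 : price ≤ 1 := by linarith [price_lt]
    simp [sellSecond, mem_square, hp1]
  have h2 : volume ({t : ℝ | ![1, t] ∈ sellSecond} ∩ Icc (0 : ℝ) 1) = 0 := by
    refine measure_mono_null (t := {1}) (fun t ht => ?_) (by simp)
    exact le_antisymm ht.2.2 ht.1.2.2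
  rw [muPos_apply measurableSet_sellSecond, h1, h2]
  simp [sellSecond, hp]

/-! ### The dual matching -/

theorem measurable_stripMass_diff (i j : Fin 2) :
    Measurable fun y : Fin 2 → ℝ => 1 - stripMass (y i - y j) :=
  ((continuous_stripMass.comp
    ((continuous_coord i).sub (continuous_coord j))).measurable).const_sub 1

theorem measurable_match_origin :
    Measurable fun y : Fin 2 → ℝ => ((0 : Fin 2 → ℝ), y) :=
  measurable_const.prodMk measurable_id

theorem measurable_match_right :
    Measurable fun y : Fin 2 → ℝ => ((![1, 1 - stripMass (y 0 - y 1)] : Fin 2 → ℝ), y) :=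
  (measurable_edge_right.comp (measurable_stripMass_diff 0 1)).prodMk measurable_id

theorem measurable_match_top :
    Measurable fun y : Fin 2 → ℝ => ((![1 - stripMass (y 1 - y 0), 1] : Fin 2 → ℝ), y) :=
  (measurable_edge_top.comp (measurable_stripMass_diff 1 0)).prodMk measurable_id

theorem gammaStar_fst : gammaStar.fst = muPos := by
  rw [gammaStar, Measure.fst, Measure.map_add _ _ measurable_fst,
    Measure.map_add _ _ measurable_fst, Measure.map_map measurable_fst measurable_match_origin,
    Measure.map_map measurable_fst measurable_match_right,
    Measure.map_map measurable_fst measurable_match_top, muPos,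
    ← map_one_sub_stripMass_sellFirst,
    Measure.map_map measurable_edge_right (measurable_stripMass_diff 0 1),
    map_one_sub_stripMass_sellFirst, ← map_one_sub_stripMass_sellSecond,
    Measure.map_map measurable_edge_top (measurable_stripMass_diff 1 0)]
  have h : (muNeg.restrict noSale).map (Prod.fst ∘ fun y => ((0 : Fin 2 → ℝ), y))
      = Measure.dirac 0 := by
    have : (Prod.fst ∘ fun y : Fin 2 → ℝ => ((0 : Fin 2 → ℝ), y)) = fun _ => 0 := rfl
    rw [this, Measure.map_const]
    simp [muNeg_noSale]
  rw [h]
  rfl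

theorem gammaStar_snd : gammaStar.snd = muNeg := by
  rw [gammaStar, Measure.snd, Measure.map_add _ _ measurable_snd,
    Measure.map_add _ _ measurable_snd, Measure.map_map measurable_snd measurable_match_origin,
    Measure.map_map measurable_snd measurable_match_right,
    Measure.map_map measurable_snd measurable_match_top]
  have h : ∀ g : (Fin 2 → ℝ) → (Fin 2 → ℝ), (Prod.snd ∘ fun y => (g y, y)) = id := fun _ => rfl
  rw [h (fun _ => 0), h, h, Measure.map_id, Measure.map_id, Measure.map_id, muNeg_restrict_cells]

theorem ae_gammaStar {p : (Fin 2 → ℝ) × (Fin 2 → ℝ) → Prop} (hp : MeasurableSet {z | p z})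
    (h0 : ∀ y ∈ noSale, p (0, y))
    (h1 : ∀ y ∈ sellFirst, p (![1, 1 - stripMass (y 0 - y 1)], y))
    (h2 : ∀ y ∈ sellSecond, p (![1 - stripMass (y 1 - y 0), 1], y)) : ∀ᵐ z ∂gammaStar, p z := by
  rw [gammaStar, ae_add_measure_iff, ae_add_measure_iff,
    ae_map_iff measurable_match_origin.aemeasurable hp,
    ae_map_iff measurable_match_right.aemeasurable hp,
    ae_map_iff measurable_match_top.aemeasurable hp]
  exact ⟨⟨ae_restrict_of_forall_mem measurableSet_noSale h0,
    ae_restrict_of_forall_mem measurableSet_sellFirst h1⟩,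
    ae_restrict_of_forall_mem measurableSet_sellSecond h2⟩

/-- Both points lie on the piece `x 0 - price` of `uStar`, so the surplus difference is `1 - y 0`;
by `le_stripMass` this is also the largest term of `ell`. -/
theorem match_right {y : Fin 2 → ℝ} (hy : y ∈ sellFirst) :
    ![1, 1 - stripMass (y 0 - y 1)] ∈ sellFirst ∧
      uStar ![1, 1 - stripMass (y 0 - y 1)] - uStar y
        = ell atMostOne ![1, 1 - stripMass (y 0 - y 1)] y := by
  have hp := price_lt
  have hd := diff_mem_Icc hy
  have hle := le_stripMass hd
  obtain ⟨hs0, hs1⟩ := stripMass_mem_Icc hd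
  obtain ⟨hsq, h1, h2⟩ := hy
  rw [mem_square] at hsq
  constructor
  · refine ⟨mem_square.2 ?_, ?_, ?_⟩ <;> simp only [Matrix.cons_val_zero, Matrix.cons_val_one]
    · refine ⟨⟨?_, ?_⟩, ?_, ?_⟩ <;> linarith
    · linarith
    · linarith
  · simp only [ell_atMostOne, uStar, Matrix.cons_val_zero, Matrix.cons_val_one]
    rw [max_eq_left (a := 1 - price) (by linarith), max_eq_right (b := 1 - price) (by linarith),
      max_eq_left (a := y 0 - price) (by linarith), max_eq_right (b := y 0 - price) (by linarith),
      max_eq_left (a := 1 - y 0) (by linarith), max_eq_right (b := 1 - y 0) (by linarith)]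
    ring

theorem uStar_exchange (x : Fin 2 → ℝ) : uStar (exchange x) = uStar x := by
  simp [uStar, exchange, max_comm]

theorem ell_exchange (x y : Fin 2 → ℝ) :
    ell atMostOne (exchange x) (exchange y) = ell atMostOne x y := by
  simp [ell_atMostOne, exchange, max_comm]

theorem match_top {y : Fin 2 → ℝ} (hy : y ∈ sellSecond) :
    ![1 - stripMass (y 1 - y 0), 1] ∈ sellSecond ∧
      uStar ![1 - stripMass (y 1 - y 0), 1] - uStar y
        = ell atMostOne ![1 - stripMass (y 1 - y 0), 1] y := by
  rw [← preimage_exchange_sellFirst] at hy ⊢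
  obtain ⟨h1, h2⟩ := match_right hy
  refine ⟨h1, ?_⟩
  rw [← uStar_exchange, ← uStar_exchange y, ← ell_exchange]
  exact h2

theorem gammaStar_ae :
    ∀ᵐ z ∂gammaStar,
      (∃ s ∈ ({![0, 0], ![1, 0], ![0, 1]} : Set (Fin 2 → ℝ)),
        z.1 ∈ cell square uStar s ∧ z.2 ∈ cell square uStar s) ∧
      uStar z.1 - uStar z.2 = ell atMostOne z.1 z.2 := by
  have hp := price_pos
  simp only [mem_insert_iff, mem_singleton_iff, exists_eq_or_imp, exists_eq_left, cell_noSale,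
    cell_sellFirst, cell_sellSecond]
  refine ae_gammaStar ?_ (fun y hy => ⟨Or.inl ⟨?_, hy⟩, ?_⟩)
    (fun y hy => ⟨Or.inr (Or.inl ⟨(match_right hy).1, hy⟩), (match_right hy).2⟩)
    (fun y hy => ⟨Or.inr (Or.inr ⟨(match_top hy).1, hy⟩), (match_top hy).2⟩)
  · exact ((measurableSet_noSale.prod measurableSet_noSale).union
      ((measurableSet_sellFirst.prod measurableSet_sellFirst).union
        (measurableSet_sellSecond.prod measurableSet_sellSecond))).inter
      (isClosed_eq ((continuous_uStar.comp continuous_fst).sub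
        (continuous_uStar.comp continuous_snd)) continuous_ell_atMostOne).measurableSet
  · simp [noSale, mem_square, hp.le]
  · obtain ⟨hsq, h0, h1⟩ := hy
    rw [mem_square] at hsq
    rw [uStar_zero, uStar, ell_atMostOne]
    simp only [Pi.zero_apply, zero_sub]
    rw [max_eq_left (max_le (by linarith) (by linarith)), max_eq_left, neg_zero]
    exact max_le (by linarith [hsq.1.1]) (by linarith [hsq.2.1])

/-! ### Optimality -/

theorem gammaStar_compl : gammaStar (square ×ˢ square)ᶜ = 0 := by
  have h : ∀ᵐ z ∂gammaStar, z ∈ square ×ˢ square := by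
    filter_upwards [gammaStar_ae] with z ⟨⟨s, _, h1, h2⟩, _⟩
    exact ⟨h1.1, h2.1⟩
  exact mem_ae_iff.1 h

theorem mu_eq_gammaStar : gammaStar.fst.toSignedMeasure - gammaStar.snd.toSignedMeasure = mu := by
  rw [mu, Measure.toSignedMeasure_congr gammaStar_fst, Measure.toSignedMeasure_congr gammaStar_snd]

theorem dualFeasible_gammaStar : DualFeasible square atMostOne mu gammaStar := by
  refine ⟨gammaStar_compl, fun u _ => ?_⟩
  rw [mu_eq_gammaStar]

/-- Complementary slackness: the matched pairs are tight, so the primal and dual values coincide. -/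
theorem integral_uStar_mu :
    ∫ᵛ x, uStar x ∂<•mu = ∫ z, ell atMostOne z.1 z.2 ∂gammaStar := by
  rw [← mu_eq_gammaStar, (integral_fst_sub_snd isCompact_square gammaStar_compl
    continuous_uStar.continuousOn).1]
  exact integral_congr_ae (gammaStar_ae.mono fun z hz => hz.2)

/-- Weak duality. -/
theorem integral_mu_le_of_dualFeasible {u : (Fin 2 → ℝ) → ℝ}
    (hu : u ∈ surplusFunctions square atMostOne)
    {γ : Measure ((Fin 2 → ℝ) × (Fin 2 → ℝ))} [IsFiniteMeasure γ]
    (hγ : DualFeasible square atMostOne mu γ) :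
    ∫ᵛ x, u x ∂<•mu ≤ ∫ z, ell atMostOne z.1 z.2 ∂γ := by
  have hc := (lipschitzOnWith_of_mem_surplusFunctions hu).continuousOn
  obtain ⟨h1, h2⟩ := integral_fst_sub_snd isCompact_square hγ.1 hc
  refine (hγ.2 u hu).trans ?_
  have hm : ∀ᵐ z ∂γ, z ∈ square ×ˢ square := mem_ae_iff.2 hγ.1
  have hi : Integrable (fun z : (Fin 2 → ℝ) × (Fin 2 → ℝ) => ell atMostOne z.1 z.2) γ := by
    have h := (continuous_ell_atMostOne.continuousOn.integrableOn_compact (μ := γ)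
      (isCompact_square.prod isCompact_square))
    rwa [IntegrableOn, Measure.restrict_eq_self_of_ae_mem hm] at h
  rw [h1]
  refine integral_mono_ae h2 hi ?_
  filter_upwards [hm] with z hz
  exact sub_le_ell isCompact_atMostOne hu hz.1 hz.2

theorem integral_mu_le_uStar {u : (Fin 2 → ℝ) → ℝ} (hu : u ∈ surplusFunctions square atMostOne) :
    ∫ᵛ x, u x ∂<•mu ≤ ∫ᵛ x, uStar x ∂<•mu :=
  (integral_mu_le_of_dualFeasible hu dualFeasible_gammaStar).trans_eq integral_uStar_mu.symm

theorem zero_mem_square : (0 : Fin 2 → ℝ) ∈ square := by simp [mem_square]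

theorem implements_isOptimal {M : Mechanism 2} (h : M.Implements square eitherItemMenu) :
    M.IsOptimal square atMostOne uniformTypes := by
  have hs : ∀ x ∈ square, M.surplus x = uStar x := fun x hx => implements_surplus h hx
  have hF := implements_feasible h
  refine ⟨hF, h.truthful, fun x hx => hs x hx ▸ uStar_nonneg x, fun M' hF' hT' hR' => ?_⟩
  have hu := M'.surplus_mem_surplusFunctions convex_square hF' hT'
  have hc := (lipschitzOnWith_of_mem_surplusFunctions
    (M.surplus_mem_surplusFunctions convex_square hF h.truthful)).continuousOn
  have hint : ∫ᵛ x, M.surplus x ∂<•mu = ∫ᵛ x, uStar x ∂<•mu := by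
    have hae : ∀ {ν : Measure (Fin 2 → ℝ)}, ν squareᶜ = 0 →
        ∫ x, M.surplus x ∂ν = ∫ x, uStar x ∂ν := fun {ν} hν =>
      integral_congr_ae <| by
        have hm : ∀ᵐ x ∂ν, x ∈ square := mem_ae_iff.2 hν
        filter_upwards [hm] with x hx using hs x hx
    rw [integral_mu hc, integral_mu continuous_uStar.continuousOn, hae muPos_compl,
      hae muNeg_compl]
  rw [(revenue_eq hF' hT').2, (revenue_eq hF h.truthful).2, hint, hs 0 zero_mem_square, uStar_zero]
  -- Rationality at the origin discards the term `-surplus 0` of the competitor, while `uStar` loses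
  -- nothing there.
  linarith [integral_mu_le_uStar hu, hR' 0 zero_mem_square]

end OptimalMechanism

end

open OptimalMechanism in
/-- Two i.i.d. uniform items, at most one of which may be allocated: offering either item at price
`1/√3` is optimal, and the matching `gammaStar` certifies it. -/
theorem mainTheorem7 :
    -- the mechanism: every implementation of the menu is optimal
    (eitherItem.Implements square eitherItemMenu ∧
      ∀ M : Mechanism 2, M.Implements square eitherItemMenu →
        M.IsOptimal square atMostOne uniformTypes ∧ ∀ x ∈ square, M.surplus x = uStar x) ∧
    -- `mu` expresses the revenue of every feasible truthful mechanism
    (∀ M : Mechanism 2, M.Feasible square atMostOne → M.Truthful square →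
      M.surplus ∈ surplusFunctions square atMostOne ∧
      MeasureTheory.Integrable M.pay uniformTypes ∧
      M.revenue uniformTypes = (∫ᵛ x, M.surplus x ∂<•mu) - M.surplus 0) ∧
    -- `uStar` solves the primal problem
    (uStar ∈ surplusFunctions square atMostOne ∧
      ∀ u ∈ surplusFunctions square atMostOne, ∫ᵛ x, u x ∂<•mu ≤ ∫ᵛ x, uStar x ∂<•mu) ∧
    -- the three cells, each of which integrates to zero
    (cell square uStar ![0, 0] = noSale ∧ cell square uStar ![1, 0] = sellFirst ∧
      cell square uStar ![0, 1] = sellSecond ∧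
      mu noSale = 0 ∧ mu sellFirst = 0 ∧ mu sellSecond = 0) ∧
    -- `gammaStar` matches the positive to the negative part of `mu` ...
    (gammaStar.fst = muPos ∧ gammaStar.snd = muNeg) ∧
    -- ... within the cells, respecting `ell` ...
    (∀ᵐ z ∂gammaStar,
      (∃ s ∈ ({![0, 0], ![1, 0], ![0, 1]} : Set (Fin 2 → ℝ)),
        z.1 ∈ cell square uStar s ∧ z.2 ∈ cell square uStar s) ∧
      uStar z.1 - uStar z.2 = ell atMostOne z.1 z.2) ∧
    -- ... and solves the dual problem, with the same value as the primal problem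
    (DualFeasible square atMostOne mu gammaStar ∧
      (∀ (γ : MeasureTheory.Measure ((Fin 2 → ℝ) × (Fin 2 → ℝ)))
        [MeasureTheory.IsFiniteMeasure γ], DualFeasible square atMostOne mu γ →
        ∫ z, ell atMostOne z.1 z.2 ∂gammaStar ≤ ∫ z, ell atMostOne z.1 z.2 ∂γ) ∧
      ∫ᵛ x, uStar x ∂<•mu = ∫ z, ell atMostOne z.1 z.2 ∂gammaStar) := by
  refine ⟨⟨eitherItem_implements, fun M hM => ⟨implements_isOptimal hM,
    fun x hx => implements_surplus hM hx⟩⟩,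
    fun M hF hT => ⟨M.surplus_mem_surplusFunctions convex_square hF hT, revenue_eq hF hT⟩,
    ⟨uStar_mem_surplusFunctions, fun u hu => integral_mu_le_uStar hu⟩,
    ⟨cell_noSale, cell_sellFirst, cell_sellSecond, mu_noSale, mu_sellFirst, mu_sellSecond⟩,
    ⟨gammaStar_fst, gammaStar_snd⟩, gammaStar_ae,
    ⟨dualFeasible_gammaStar, fun γ _ hγ => ?_, integral_uStar_mu⟩⟩
  rw [← integral_uStar_mu]
  exact integral_mu_le_of_dualFeasible uStar_mem_surplusFunctions hγ
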